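/- A metric graph $G$ is obtained from finitely many real intervals of positive length (its edges) and finitely many points (its vertices) by gluing each endpoint of each interval to a vertex; $d$ denotes its path metric, i.e. the largest metric that is at most the interval metric on each edge (distances between different components are infinite). Suppose that every edge of $G$ has length at least $1$ and that $G$ contains a theta, i.e. a subset which is a copy of two points joined by three internally disjoint segments. (The copy need only be topological, equivalently isometric for the path metric measured inside the subset; this includes every theta on which $d$ itself agrees with that path metric.) Then there are a set $B$ of three points and a set $R$ of three points of $G$, all at finite mutual distances, such that \[ \sum_{\{x,y\}\subseteq R} d(x,y) + \sum_{\{x,y\}\subseteq B} d(x,y) - \sum_{x\in R,\ y\in B} d(x,y) \ \ge\ \frac1{12}, \] where in the first two sums every unordered pair is counted once. In particular, $G$ does not have negative type: there is a finitely supported $\omega : G\to\mathbb{R}$, supported on points at finite mutual distances, with $\sum_x \omega(x)=0$ and $\sum_{x,y}\omega(x)\omega(y)d(x,y)>0$. -/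

import Mathlib

open scoped ENNReal

universe u v

/-- The combinatorial data of a metric graph: finitely many vertices, finitely many segments (edges)
of positive length, and, for each of the two endpoints of a segment, the unique vertex to which it is
glued. Loops, parallel edges, isolated vertices and disconnected graphs are allowed. -/
structure MetricGraph where
  /-- the vertices -/
  V : Type u
  /-- the edges -/
  E : Type v
  finite_V : Finite V
  finite_E : Finite E
  /-- the length of each segment -/
  len : E → ℝ
  len_pos : ∀ e, 0 < len e
  /-- the vertex to which the endpoint `0` of a segment is glued -/
  src : E → V
  /-- the vertex to which the endpoint `len e` of a segment is glued -/
  tgt : E → V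

namespace MetricGraph

/-- The disjoint union of the vertices and of the segments `[0, len e]`, before gluing. -/
inductive PrePoint (G : MetricGraph.{u, v}) : Type (max u v)
  | vertex (x : G.V) : PrePoint G
  | onEdge (e : G.E) (t : Set.Icc (0 : ℝ) (G.len e)) : PrePoint G

/-- `δ` is an extended pseudometric on the disjoint union that is bounded above by the metric
of each segment and that vanishes on points that are glued together. -/
structure IsAdmissible (G : MetricGraph.{u, v}) (δ : G.PrePoint → G.PrePoint → ℝ≥0∞) : Prop where
  self : ∀ x, δ x x = 0
  comm : ∀ x y, δ x y = δ y x
  triangle : ∀ x y z, δ x z ≤ δ x y + δ y z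
  edge : ∀ (e : G.E) (s t : Set.Icc (0 : ℝ) (G.len e)),
    δ (.onEdge e s) (.onEdge e t) ≤ ENNReal.ofReal |(s : ℝ) - t|
  glue_src : ∀ e : G.E, δ (.onEdge e ⟨0, le_rfl, (G.len_pos e).le⟩) (.vertex (G.src e)) = 0
  glue_tgt : ∀ e : G.E, δ (.onEdge e ⟨G.len e, (G.len_pos e).le, le_rfl⟩) (.vertex (G.tgt e)) = 0

/-- The maximal admissible extended pseudometric (see `preDist_isAdmissible` and
`le_preDist`). -/
noncomputable def preDist (G : MetricGraph.{u, v}) (x y : G.PrePoint) : ℝ≥0∞ :=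
  ⨆ (δ : G.PrePoint → G.PrePoint → ℝ≥0∞) (_ : G.IsAdmissible δ), δ x y

theorem le_preDist (G : MetricGraph.{u, v}) {δ : G.PrePoint → G.PrePoint → ℝ≥0∞}
    (h : G.IsAdmissible δ) (x y : G.PrePoint) : δ x y ≤ G.preDist x y :=
  le_iSup₂ (f := fun (δ : G.PrePoint → G.PrePoint → ℝ≥0∞) (_ : G.IsAdmissible δ) => δ x y) δ h

theorem preDist_isAdmissible (G : MetricGraph.{u, v}) : G.IsAdmissible G.preDist where
  self x := by
    refine le_antisymm (iSup₂_le fun δ h => (h.self x).le) bot_le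
  comm x y := by
    apply le_antisymm <;> refine iSup₂_le fun δ h => ?_
    · exact (h.comm x y).le.trans (G.le_preDist h y x)
    · exact (h.comm y x).le.trans (G.le_preDist h x y)
  triangle x y z := iSup₂_le fun _ h =>
    (h.triangle x y z).trans (add_le_add (G.le_preDist h x y) (G.le_preDist h y z))
  edge e s t := iSup₂_le fun _ h => h.edge e s t
  glue_src e := le_antisymm (iSup₂_le fun _ h => (h.glue_src e).le) bot_le
  glue_tgt e := le_antisymm (iSup₂_le fun _ h => (h.glue_tgt e).le) bot_le

noncomputable instance (G : MetricGraph.{u, v}) : PseudoEMetricSpace G.PrePoint where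
  edist := G.preDist
  edist_self := G.preDist_isAdmissible.self
  edist_comm := G.preDist_isAdmissible.comm
  edist_triangle := G.preDist_isAdmissible.triangle

/-- The metric graph as a space: the glued points are identified and the metric is the maximal one.
The distance between points of different components is `∞`. -/
abbrev Space (G : MetricGraph.{u, v}) : Type (max u v) := SeparationQuotient G.PrePoint

/-- The graph with two vertices and three segments that all join them. -/
def theta (l : Fin 3 → ℝ) (hl : ∀ i, 0 < l i) : MetricGraph.{0, 0} where
  V := Bool
  E := Fin 3
  finite_V := inferInstance
  finite_E := inferInstance
  len := l
  len_pos := hl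
  src _ := false
  tgt _ := true

/-- `G` contains a theta: some subset of `G` is a copy of two points joined by three internally
disjoint segments. The copy is topological (equivalently, isometric for the path metric measured
inside the subset): distances in `G` between two points of the subset may be smaller than those
measured inside it. A distance-preserving copy is a special case, see
`containsTheta_of_isometry`. -/
def ContainsTheta (G : MetricGraph.{u, v}) : Prop :=
  ∃ (l : Fin 3 → ℝ) (hl : ∀ i, 0 < l i) (f : (theta l hl).Space → G.Space), Topology.IsEmbedding f

theorem containsTheta_of_isometry (G : MetricGraph.{u, v}) (l : Fin 3 → ℝ) (hl : ∀ i, 0 < l i)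
    (f : (theta l hl).Space → G.Space) (hf : Isometry f) : G.ContainsTheta :=
  ⟨l, hl, f, hf.isEmbedding⟩

end MetricGraph

/-- Negative type: `∑ ω(x) ω(y) d(x, y) ≤ 0` for every finitely supported `ω` of total weight `0`.
In a space with infinite distances only those `ω` are considered whose support has finite mutual
distances; for a metric space this is no restriction. -/
def HasNegativeType (X : Type*) [EMetricSpace X] : Prop :=
  ∀ ω : X →₀ ℝ, (∀ x ∈ ω.support, ∀ y ∈ ω.support, edist x y ≠ ∞) →
    ∑ x ∈ ω.support, ω x = 0 →
    ∑ x ∈ ω.support, ∑ y ∈ ω.support, ω x * ω y * (edist x y).toReal ≤ 0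

/-!
Lower bounds on distances come from the universal property of the path metric
(`exists_lipschitzWith`): a map that is `1`-Lipschitz on each edge and consistent at the vertices is
`1`-Lipschitz. The proof has three parts.

*From the theta to an isometric cycle with an ear.* By the intermediate value theorem on the three
arms, a continuous function that separates the two branch points takes each intermediate value at
three points (`ContainsTheta.exists_threeLinked`). With tent functions this shows that the branch
points are vertices `a` and `b`, and with functions interpolating the indicator of a set of vertices
that no two edges separate them. Choose an edge `e` from `a` to a vertex from which `b` can be
reached without passing through `a`, and close a shortest path between the ends of `e` in `G - e`
by `e`. The resulting cycle is always isometric, because the distance from `a` in `G - e` induces a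
`1`-Lipschitz retraction of `G` onto a circle (`exists_isometricLoop`). Without an ear, i.e. a path
off the edges of the cycle between distinct vertices of it, the two edges of the cycle at `a` would
separate `a` from `b` (`exists_isometricLoop_ear`).

*From the ear to an edge.* Take a shortest ear, and let `e` be its middle edge, with ends `p` and
`q`, and `u` and `v` the vertices of the cycle nearest to them. A path from `p` to `v` either passes
through `u`, which makes it longer than `d(p, u)` by at least `1`, or contains the rest of an ear
that begins with a path from `u` to `p` and is no shorter than the shortest one
(`min_le_ds_of_ne_nearest`); likewise for paths from `q` to `u`. It follows that the difference
`d(q, x) - d(p, x)` is larger at `x = u` than at `x = v` by at least `1` (`hasGap_of_ear`).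

*From the edge to six points.* Write `x'` for the antipode of `x` on the cycle, of length `L`. Two
antipodal pairs satisfy `d(x, x') + d(y, y') = L = d(x, y) + d(x, y') + d(x', y) + d(x', y')`. Hence
for `R = {x, x', r}` and `B = {y, y', b}`, with `r` and `b` on `e` at distance `τ`, the required
expression is at least `g r x - g b x + g b y - g r y - τ`, where `g r x = d(r, x) + d(r, x')`. As
`r` moves along `e`, the rate of change of `g r x` is `2`, `0` or `-2`, according to which ends of
`e` the geodesics from `r` to `x` and `x'` use. By the oscillation of `d(q, x) - d(p, x)` and the
intermediate value theorem, on an interval of length `1 / 12` the rates for some `x` and `y` differ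
by at least `2` (`hasGap_of_oscillation`), and the expression is at least `2 τ - τ = 1 / 12`.
-/

/-! ### Points of a metric graph and maps out of it -/

namespace MetricGraph

variable {G : MetricGraph.{u, v}}

/-- The image of a vertex in the space. -/
noncomputable def vx (x : G.V) : G.Space := SeparationQuotient.mk (.vertex x)

/-- The point at position `t` of the edge `e`; positions outside `[0, len e]` are moved to the
nearest endpoint, so that `pt e` is `1`-Lipschitz on all of `ℝ`. -/
noncomputable def pt (e : G.E) (t : ℝ) : G.Space :=
  SeparationQuotient.mk (.onEdge e (Set.projIcc 0 (G.len e) (G.len_pos e).le t))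

theorem pt_zero (e : G.E) : pt e 0 = vx (G.src e) := by
  refine SeparationQuotient.mk_eq_mk.2 (EMetric.inseparable_iff.2 ?_)
  rw [Set.projIcc_left]
  exact G.preDist_isAdmissible.glue_src e

theorem pt_len (e : G.E) : pt e (G.len e) = vx (G.tgt e) := by
  refine SeparationQuotient.mk_eq_mk.2 (EMetric.inseparable_iff.2 ?_)
  rw [Set.projIcc_right]
  exact G.preDist_isAdmissible.glue_tgt e

theorem lipschitzWith_pt (e : G.E) : LipschitzWith 1 (pt e) := by
  intro s t
  have h := LipschitzWith.projIcc (G.len_pos e).le s t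
  refine le_trans ?_ h
  rw [Subtype.edist_eq, edist_dist, Real.dist_eq]
  exact G.preDist_isAdmissible.edge e _ _

theorem edist_path_le {γ : ℝ → G.Space} (hγ : LipschitzWith 1 γ) (s t : ℝ) :
    edist (γ s) (γ t) ≤ ENNReal.ofReal |s - t| := by
  have h := hγ s t
  rwa [ENNReal.coe_one, one_mul, edist_dist, Real.dist_eq] at h

theorem edist_pt_le (e : G.E) (s t : ℝ) : edist (pt e s) (pt e t) ≤ ENNReal.ofReal |s - t| :=
  edist_path_le (lipschitzWith_pt e) s t

theorem exists_eq_vx_or_pt (y : G.Space) :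
    (∃ x, y = vx x) ∨ ∃ e, ∃ t ∈ Set.Icc 0 (G.len e), y = pt e t := by
  obtain ⟨p, rfl⟩ := SeparationQuotient.surjective_mk y
  cases p with
  | vertex x => exact .inl ⟨x, rfl⟩
  | onEdge e t => exact .inr ⟨e, t, t.2, by simp [pt]⟩

/-- The universal property of the path metric: a family of `1`-Lipschitz maps on the edges that
agree at the vertices glues to a `1`-Lipschitz map on the space. Every lower bound on a distance
is obtained from it. -/
theorem exists_lipschitzWith {Y : Type*} [EMetricSpace Y] (g : G.V → Y) (k : G.E → ℝ → Y)
    (h0 : ∀ e, k e 0 = g (G.src e)) (h1 : ∀ e, k e (G.len e) = g (G.tgt e))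
    (hk : ∀ e, ∀ s ∈ Set.Icc 0 (G.len e), ∀ t ∈ Set.Icc 0 (G.len e),
      edist (k e s) (k e t) ≤ ENNReal.ofReal |s - t|) :
    ∃ Φ : G.Space → Y, LipschitzWith 1 Φ ∧ (∀ x, Φ (vx x) = g x) ∧
      ∀ e, ∀ t ∈ Set.Icc 0 (G.len e), Φ (pt e t) = k e t := by
  let Φ₀ : G.PrePoint → Y := fun p => match p with
    | .vertex x => g x
    | .onEdge e t => k e t
  have hadm : G.IsAdmissible fun x y => edist (Φ₀ x) (Φ₀ y) :=
    { self := fun x => edist_self _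
      comm := fun x y => edist_comm _ _
      triangle := fun x y z => edist_triangle _ _ _
      edge := fun e s t => hk e s s.2 t t.2
      glue_src := fun e => by simp [Φ₀, h0]
      glue_tgt := fun e => by simp [Φ₀, h1] }
  have hle : ∀ x y, edist (Φ₀ x) (Φ₀ y) ≤ edist x y := fun x y => G.le_preDist hadm x y
  refine ⟨SeparationQuotient.lift Φ₀ fun x y hxy => ?_, ?_, fun x => rfl, fun e t ht => ?_⟩
  · have := hle x y
    rw [EMetric.inseparable_iff.1 hxy] at this
    exact edist_le_zero.1 this
  · intro x y
    obtain ⟨p, rfl⟩ := SeparationQuotient.surjective_mk x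
    obtain ⟨q, rfl⟩ := SeparationQuotient.surjective_mk y
    simpa using hle p q
  · simp only [pt, SeparationQuotient.lift_mk, Φ₀, Set.projIcc_of_mem _ ht]

/-- The linear interpolation along an edge of length `l` of the values `a` and `b` at its ends. -/
noncomputable def lin (l a b t : ℝ) : ℝ := a + t / l * (b - a)

theorem abs_lin_sub_lin_le {l a b : ℝ} (hl : 0 < l) (h : |b - a| ≤ l) (s t : ℝ) :
    |lin l a b s - lin l a b t| ≤ |s - t| := by
  have : lin l a b s - lin l a b t = (s - t) * ((b - a) / l) := by
    unfold lin; field_simp; ring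
  rw [this, abs_mul, abs_div, abs_of_pos hl]
  exact mul_le_of_le_one_right (abs_nonneg _) ((div_le_one hl).2 h)

theorem lin_zero (l a b : ℝ) : lin l a b 0 = a := by simp [lin]

theorem lin_self {l : ℝ} (hl : 0 < l) (a b : ℝ) : lin l a b l = b := by
  simp [lin, hl.ne']

theorem exists_lipschitzWith_lin (g : G.V → ℝ)
    (hg : ∀ e, |g (G.tgt e) - g (G.src e)| ≤ G.len e) :
    ∃ Φ : G.Space → ℝ, LipschitzWith 1 Φ ∧ (∀ x, Φ (vx x) = g x) ∧
      ∀ e, ∀ t ∈ Set.Icc 0 (G.len e),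
        Φ (pt e t) = lin (G.len e) (g (G.src e)) (g (G.tgt e)) t := by
  refine exists_lipschitzWith g (fun e t => lin (G.len e) (g (G.src e)) (g (G.tgt e)) t)
    (fun e => lin_zero _ _ _) (fun e => lin_self (G.len_pos e) _ _) fun e s _ t _ => ?_
  rw [edist_dist, Real.dist_eq]
  exact ENNReal.ofReal_le_ofReal (abs_lin_sub_lin_le (G.len_pos e) (hg e) s t)

/-- The distance as a real number, with the junk value `0` between different components. -/
noncomputable def ds (x y : G.Space) : ℝ := (edist x y).toReal

/-- Two points at finite distance, i.e. in the same component. -/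
def Near (x y : G.Space) : Prop := edist x y ≠ ∞

theorem Near.symm {x y : G.Space} (h : Near x y) : Near y x := by
  rwa [Near, edist_comm]

theorem Near.trans {x y z : G.Space} (h : Near x y) (h' : Near y z) : Near x z :=
  ne_top_of_le_ne_top (ENNReal.add_ne_top.2 ⟨h, h'⟩) (edist_triangle x y z)

theorem ds_self (x : G.Space) : ds x x = 0 := by simp [ds]

theorem ds_comm (x y : G.Space) : ds x y = ds y x := by rw [ds, edist_comm, ds]

theorem ds_nonneg (x y : G.Space) : 0 ≤ ds x y := ENNReal.toReal_nonneg

theorem ds_of_not_near {x y : G.Space} (h : ¬ Near x y) : ds x y = 0 := by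
  rw [Near, not_not] at h; simp [ds, h]

theorem ds_triangle {x y z : G.Space} (h : Near x y) (h' : Near y z) :
    ds x z ≤ ds x y + ds y z := by
  rw [ds, ds, ds, ← ENNReal.toReal_add h h']
  exact ENNReal.toReal_mono (ENNReal.add_ne_top.2 ⟨h, h'⟩) (edist_triangle x y z)

theorem near_of_edist_le {x y : G.Space} {r : ℝ} (h : edist x y ≤ ENNReal.ofReal r) : Near x y :=
  ne_top_of_le_ne_top ENNReal.ofReal_ne_top h

theorem ds_le_of_edist_le {x y : G.Space} {r : ℝ} (hr : 0 ≤ r)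
    (h : edist x y ≤ ENNReal.ofReal r) : ds x y ≤ r :=
  ENNReal.toReal_le_of_le_ofReal hr h

theorem near_pt (e : G.E) (s t : ℝ) : Near (pt e s) (pt e t) := near_of_edist_le (edist_pt_le e s t)

theorem ds_pt_le (e : G.E) (s t : ℝ) : ds (pt e s) (pt e t) ≤ |s - t| :=
  ds_le_of_edist_le (abs_nonneg _) (edist_pt_le e s t)

theorem near_src_pt (e : G.E) (t : ℝ) : Near (vx (G.src e)) (pt e t) := pt_zero e ▸ near_pt e 0 t

theorem near_src_tgt (e : G.E) : Near (vx (G.src e)) (vx (G.tgt e)) := pt_len e ▸ near_src_pt e _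

theorem ds_src_tgt_le (e : G.E) : ds (vx (G.src e)) (vx (G.tgt e)) ≤ G.len e := by
  have := ds_pt_le e 0 (G.len e)
  rwa [pt_zero, pt_len, zero_sub, abs_neg, abs_of_pos (G.len_pos e)] at this

theorem dist_le_ds {Y : Type*} [MetricSpace Y] {Φ : G.Space → Y} (hΦ : LipschitzWith 1 Φ)
    {x y : G.Space} (h : Near x y) : dist (Φ x) (Φ y) ≤ ds x y := by
  have := hΦ x y
  rw [ENNReal.coe_one, one_mul, edist_dist] at this
  exact (ENNReal.ofReal_le_iff_le_toReal h).1 this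

theorem abs_sub_le_ds {Φ : G.Space → ℝ} (hΦ : LipschitzWith 1 Φ) {x y : G.Space} (h : Near x y) :
    |Φ x - Φ y| ≤ ds x y :=
  dist_le_ds hΦ h

/-- Moving the first argument changes `ds` by at most the distance, also where the junk value
occurs. -/
theorem abs_ds_sub_ds_le {x y z : G.Space} (h : Near x y) : |ds x z - ds y z| ≤ ds x y := by
  by_cases hx : Near x z
  · have hy : Near y z := h.symm.trans hx
    rw [abs_sub_le_iff]
    have h1 := ds_triangle h hy
    have h2 := ds_triangle h.symm hx
    rw [ds_comm y x] at h2
    constructor <;> linarith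
  · have hy : ¬ Near y z := fun hy => hx (h.trans hy)
    rw [ds_of_not_near hx, ds_of_not_near hy]
    simpa using ds_nonneg x y

/-- A geodesic from a point of the edge `e` to a point `x` outside the interior of `e` leaves `e`
through one of its ends. The hypothesis on `x` says that `x` is a vertex or lies on another edge. -/
theorem le_ds_pt (e : G.E) (x : G.Space)
    (hx : (∃ z, x = vx z) ∨ ∃ f, f ≠ e ∧ ∃ t ∈ Set.Icc 0 (G.len f), x = pt f t)
    (hnear : Near (vx (G.src e)) x) {t : ℝ} (ht : t ∈ Set.Icc 0 (G.len e)) :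
    min (t + ds (vx (G.src e)) x) (G.len e - t + ds (vx (G.tgt e)) x) ≤ ds (pt e t) x := by
  classical
  have hst : |ds (vx (G.src e)) x - ds (vx (G.tgt e)) x| ≤ G.len e :=
    (abs_ds_sub_ds_le (near_src_tgt e)).trans (ds_src_tgt_le e)
  rw [abs_sub_le_iff] at hst
  obtain ⟨Φ, hΦ, hv, he⟩ := exists_lipschitzWith (G := G) (fun z => ds (vx z) x)
    (fun f s => if f = e then
      min (s + ds (vx (G.src e)) x) (G.len e - s + ds (vx (G.tgt e)) x) else ds (pt f s) x)
    (fun f => by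
      split_ifs with h
      · subst h; rw [min_eq_left] <;> linarith
      · rw [pt_zero])
    (fun f => by
      split_ifs with h
      · subst h; rw [min_eq_right] <;> linarith
      · rw [pt_len])
    (fun f s _ s' _ => by
      rw [edist_dist, Real.dist_eq]
      refine ENNReal.ofReal_le_ofReal ?_
      split_ifs with h
      · refine (abs_min_sub_min_le_max _ _ _ _).trans (max_le ?_ ?_)
        · rw [add_sub_add_right_eq_sub]
        · rw [abs_sub_comm s s']; exact le_of_eq (by ring_nf)
      · exact (abs_ds_sub_ds_le (near_pt f s s')).trans (ds_pt_le f s s'))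
  have hx0 : Φ x = 0 := by
    obtain ⟨z, rfl⟩ | ⟨f, hf, s, hs, rfl⟩ := hx
    · rw [hv, ds_self]
    · rw [he f s hs, if_neg hf, ds_self]
  have := abs_sub_le_ds hΦ ((near_src_pt e t).symm.trans hnear)
  rw [hx0, sub_zero, he e t ht, if_pos rfl] at this
  exact (le_abs_self _).trans this

/-- The edge `f` joins `x` to `y`, in one of the two directions. -/
def Joins (f : G.E) (x y : G.V) : Prop :=
  (G.src f = x ∧ G.tgt f = y) ∨ (G.src f = y ∧ G.tgt f = x)

theorem Joins.symm {f : G.E} {x y : G.V} (h : Joins f x y) : Joins f y x := Or.symm h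

theorem Joins.near {f : G.E} {x y : G.V} (h : Joins f x y) : Near (vx x) (vx y) := by
  obtain ⟨rfl, rfl⟩ | ⟨rfl, rfl⟩ := h
  exacts [near_src_tgt f, (near_src_tgt f).symm]

theorem Joins.ds_le {f : G.E} {x y : G.V} (h : Joins f x y) : ds (vx x) (vx y) ≤ G.len f := by
  obtain ⟨rfl, rfl⟩ | ⟨rfl, rfl⟩ := h
  exacts [ds_src_tgt_le f, ds_comm (G := G) _ _ ▸ ds_src_tgt_le f]

/-- `y` can be reached from `x` along edges in `F`. -/
def Reach (F : Set G.E) : G.V → G.V → Prop :=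
  Relation.ReflTransGen fun x y => ∃ f ∈ F, Joins f x y

theorem Reach.symm {F : Set G.E} {x y : G.V} (h : Reach F x y) : Reach F y x := by
  induction h with
  | refl => exact .refl
  | tail _ h ih => obtain ⟨f, hf, h⟩ := h; exact .head ⟨f, hf, h.symm⟩ ih

theorem Reach.mono {F F' : Set G.E} (hF : F ⊆ F') {x y : G.V} (h : Reach F x y) : Reach F' x y :=
  Relation.ReflTransGen.mono (fun _ _ ⟨f, hf, h⟩ => ⟨f, hF hf, h⟩) _ _ h

theorem Reach.near {F : Set G.E} {x y : G.V} (h : Reach F x y) : Near (vx x) (vx y) := by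
  induction h with
  | refl => simp [Near]
  | tail _ h ih => obtain ⟨f, -, h⟩ := h; exact ih.trans h.near

/-- A function on the vertices that changes by at most `len f` along every edge `f` bounds the
distances of vertices from below. -/
theorem abs_sub_le_ds_vx (g : G.V → ℝ) (hg : ∀ f x y, Joins f x y → g y ≤ g x + G.len f)
    {x y : G.V} (h : Near (vx x) (vx y)) : |g x - g y| ≤ ds (vx x) (vx y) := by
  obtain ⟨Φ, hΦ, hv, -⟩ := exists_lipschitzWith_lin (G := G) g fun e => by
    have h1 := hg e _ _ (.inl ⟨rfl, rfl⟩)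
    have h2 := hg e _ _ (.inr ⟨rfl, rfl⟩)
    rw [abs_sub_le_iff]; constructor <;> linarith
  simpa [hv] using abs_sub_le_ds hΦ h

theorem vx_injective : Function.Injective (vx : G.V → G.Space) := by
  classical
  intro x y hxy
  by_contra hne
  have := G.finite_E
  obtain ⟨m, hm, hm'⟩ : ∃ m : ℝ, 0 < m ∧ ∀ e, m ≤ G.len e := by
    rcases isEmpty_or_nonempty G.E with h | h
    · exact ⟨1, one_pos, fun e => h.elim e⟩
    · obtain ⟨e, he⟩ := Finite.exists_min G.len
      exact ⟨G.len e, G.len_pos e, he⟩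
  have h := abs_sub_le_ds_vx (G := G) (fun z => if z = x then m else 0) (fun f a b _ => by
    have := hm' f
    split_ifs <;> linarith) (x := x) (y := y) (by simp [hxy, Near])
  rw [hxy, ds_self, if_pos rfl, if_neg (Ne.symm hne), sub_zero, abs_of_pos hm] at h
  linarith

theorem one_le_ds_vx (hlen : ∀ e, 1 ≤ G.len e) {x y : G.V} (hne : x ≠ y)
    (h : Near (vx x) (vx y)) : 1 ≤ ds (vx x) (vx y) := by
  classical
  have := abs_sub_le_ds_vx (G := G) (fun z => if z = x then 1 else 0) (fun f a b _ => by
    have := hlen f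
    split_ifs <;> linarith) h
  simpa [hne.symm] using this

/-- A point inside an edge is neither a vertex nor a point of another edge. -/
theorem pt_ne {e : G.E} {t : ℝ} (ht : t ∈ Set.Ioo 0 (G.len e)) {x : G.Space}
    (hx : (∃ z, x = vx z) ∨ ∃ f, f ≠ e ∧ ∃ t ∈ Set.Icc 0 (G.len f), x = pt f t) : pt e t ≠ x := by
  rintro rfl
  have := le_ds_pt e _ hx (near_src_pt e t) ⟨ht.1.le, ht.2.le⟩
  rw [ds_self] at this
  have h1 := ds_nonneg (vx (G.src e)) (pt e t)
  have h2 := ds_nonneg (vx (G.tgt e)) (pt e t)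
  have h3 := ht.1
  have h4 := ht.2
  rcases min_le_iff.1 this with h | h <;> linarith

end MetricGraph

/-! ### The branch points of an embedded theta -/

namespace MetricGraph

variable {G : MetricGraph.{u, v}}

/-- The trace in `G` of the three arms of a theta with branch points `U` and `W`: every level of a
continuous function that separates `U` from `W` strictly is attained at three points. -/
def ThreeLinked (U W : G.Space) : Prop :=
  U ≠ W ∧ ∀ φ : G.Space → ℝ, Continuous φ → ∀ c, φ U < c → c < φ W →
    ∃ y : Fin 3 → G.Space, Function.Injective y ∧ ∀ i, φ (y i) = c

theorem ThreeLinked.symm {U W : G.Space} (h : ThreeLinked U W) : ThreeLinked W U := by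
  refine ⟨h.1.symm, fun φ hφ c h1 h2 => ?_⟩
  obtain ⟨y, hy, hc⟩ := h.2 (fun x => -φ x) hφ.neg (-c) (neg_lt_neg h2) (neg_lt_neg h1)
  exact ⟨y, hy, fun i => neg_injective (hc i)⟩

theorem ContainsTheta.exists_threeLinked (h : G.ContainsTheta) :
    ∃ U W : G.Space, ThreeLinked U W := by
  obtain ⟨l, hl, f, hf⟩ := h
  refine ⟨f (vx (G := theta l hl) false), f (vx (G := theta l hl) true),
    fun h => Bool.false_ne_true (vx_injective (hf.injective h)), fun φ hφ c h1 h2 => ?_⟩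
  have key : ∀ i : Fin 3, ∃ t ∈ Set.Ioo 0 (l i), φ (f (pt (G := theta l hl) i t)) = c := by
    intro i
    have hcont : Continuous fun t => φ (f (pt (G := theta l hl) i t)) :=
      hφ.comp (hf.continuous.comp (lipschitzWith_pt (G := theta l hl) i).continuous)
    have e0 : φ (f (pt (G := theta l hl) i 0)) < c :=
      (congrArg (fun z => φ (f z)) (pt_zero (G := theta l hl) i)).trans_lt h1
    have e1 : c < φ (f (pt (G := theta l hl) i (l i))) :=
      h2.trans_eq (congrArg (fun z => φ (f z)) (pt_len (G := theta l hl) i)).symm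
    exact intermediate_value_Ioo (hl i).le hcont.continuousOn ⟨e0, e1⟩
  choose t ht hc using key
  refine ⟨fun i => f (pt (G := theta l hl) i (t i)), fun i j hij => ?_, hc⟩
  by_contra hne
  exact pt_ne (G := theta l hl) (ht i)
    (.inr ⟨j, Ne.symm hne, t j, ⟨(ht j).1.le, (ht j).2.le⟩, rfl⟩) (hf.injective hij)

theorem not_injective_of_eq_or_eq {X : Type*} {y : Fin 3 → X} {p q : X}
    (h : ∀ i, y i = p ∨ y i = q) : ¬ Function.Injective y := by
  intro hy
  have h01 : y 0 ≠ y 1 := hy.ne (by decide)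
  have h02 : y 0 ≠ y 2 := hy.ne (by decide)
  have h12 : y 1 ≠ y 2 := hy.ne (by decide)
  rcases h 0 with h0 | h0 <;> rcases h 1 with h1 | h1 <;> rcases h 2 with h2 | h2 <;>
    simp_all

/-- A point inside an edge is surrounded by the two-point level sets of a tent function, so it is
not a branch point. -/
theorem ThreeLinked.exists_eq_vx {U W : G.Space} (h : ThreeLinked U W) : ∃ a, U = vx a := by
  classical
  obtain ⟨a, ha⟩ | ⟨e, t, ht, rfl⟩ := exists_eq_vx_or_pt U
  · exact ⟨a, ha⟩
  rcases ht.1.eq_or_lt with rfl | h0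
  · exact ⟨_, pt_zero e⟩
  rcases ht.2.eq_or_lt with rfl | h1
  · exact ⟨_, pt_len e⟩
  exfalso
  obtain ⟨ρ, hρ, hρ0, hρ1, hW⟩ : ∃ ρ, 0 < ρ ∧ ρ ≤ t ∧ ρ ≤ G.len e - t ∧
      ((∃ t' ∈ Set.Icc 0 (G.len e), W = pt e t' ∧ ρ ≤ |t - t'|) ∨ (∃ z, W = vx z) ∨
        ∃ f, f ≠ e ∧ ∃ t' ∈ Set.Icc 0 (G.len f), W = pt f t') := by
    have hpos : 0 < min t (G.len e - t) := lt_min h0 (by linarith)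
    obtain hz | ⟨f, t', ht', rfl⟩ := exists_eq_vx_or_pt W
    · exact ⟨_, hpos, min_le_left _ _, min_le_right _ _, .inr (.inl hz)⟩
    · by_cases hf : f = e
      · subst hf
        have hne : t ≠ t' := fun h' => h.1 (by rw [h'])
        exact ⟨min (min t (G.len f - t)) |t - t'|, lt_min hpos (abs_pos.2 (sub_ne_zero.2 hne)),
          (min_le_left _ _).trans (min_le_left _ _), (min_le_left _ _).trans (min_le_right _ _),
          .inl ⟨t', ht', rfl, min_le_right _ _⟩⟩
      · exact ⟨_, hpos, min_le_left _ _, min_le_right _ _, .inr (.inr ⟨f, hf, t', ht', rfl⟩)⟩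
  obtain ⟨Φ, hΦ, hv, he⟩ := exists_lipschitzWith (G := G) (fun _ => ρ)
    (fun f s => if f = e then min ρ |t - s| else ρ)
    (fun f => by
      split_ifs with h
      · rw [sub_zero, abs_of_pos h0, min_eq_left hρ0]
      · rfl)
    (fun f => by
      split_ifs with h
      · subst h; rw [abs_sub_comm, abs_of_pos (by linarith), min_eq_left hρ1]
      · rfl)
    (fun f s _ s' _ => by
      rw [edist_dist, Real.dist_eq]
      refine ENNReal.ofReal_le_ofReal ?_
      split_ifs with h
      · refine (abs_min_sub_min_le_max _ _ _ _).trans (max_le (by simp) ?_)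
        refine (abs_abs_sub_abs_le_abs_sub _ _).trans (le_of_eq ?_)
        rw [abs_sub_comm s s']; congr 1; ring
      · simp)
  have hU : Φ (pt e t) = 0 := by
    rw [he e t ht, if_pos rfl, sub_self, abs_zero, min_eq_right hρ.le]
  have hW : Φ W = ρ := by
    obtain ⟨t', ht', rfl, hle⟩ | ⟨z, rfl⟩ | ⟨f, hf, t', ht', rfl⟩ := hW
    · rw [he e t' ht', if_pos rfl, min_eq_left hle]
    · exact hv z
    · rw [he f t' ht', if_neg hf]
  obtain ⟨y, hy, hc⟩ := h.2 Φ hΦ.continuous (ρ / 2) (by linarith) (by linarith)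
  refine not_injective_of_eq_or_eq (p := pt e (t - ρ / 2)) (q := pt e (t + ρ / 2)) (fun i => ?_) hy
  have := hc i
  obtain ⟨z, hz⟩ | ⟨f, s, hs, hz⟩ := exists_eq_vx_or_pt (y i)
  · rw [hz, hv] at this; linarith
  · rw [hz, he f s hs] at this
    split_ifs at this with hf
    · subst hf
      rcases min_choice ρ |t - s| with hm | hm
      · rw [hm] at this; linarith
      · rw [hm] at this
        rcases abs_choice (t - s) with ha | ha <;> rw [ha] at this
        · left; rw [hz]; congr 1; linarith
        · right; rw [hz]; congr 1; linarith
    · linarith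

/-- Branch points of a theta are separated by no two edges: apply the level set property to the
function that is linear on the edges and the indicator of a cut on the vertices. -/
theorem ThreeLinked.exists_crossing (hlen : ∀ e, 1 ≤ G.len e) {a b : G.V}
    (h : ThreeLinked (vx a) (vx b)) (S : Set G.V) (ha : a ∈ S) (hb : b ∉ S) :
    ∃ f : Fin 3 → G.E, Function.Injective f ∧ ∀ i, ¬ (G.src (f i) ∈ S ↔ G.tgt (f i) ∈ S) := by
  classical
  obtain ⟨Φ, hΦ, hv, he⟩ := exists_lipschitzWith_lin (G := G) (fun z => if z ∈ S then 0 else 1)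
    (fun e => by have := hlen e; split_ifs <;> simp <;> linarith)
  obtain ⟨y, hy, hc⟩ := h.2 Φ hΦ.continuous (1 / 2)
    (by rw [hv, if_pos ha]; norm_num) (by rw [hv, if_neg hb]; norm_num)
  have key : ∀ i, ∃ f, y i = pt f (G.len f / 2) ∧ ¬ (G.src f ∈ S ↔ G.tgt f ∈ S) := by
    intro i
    have := hc i
    obtain ⟨z, hz⟩ | ⟨f, s, hs, hz⟩ := exists_eq_vx_or_pt (y i)
    · rw [hz, hv] at this
      split_ifs at this <;> norm_num at this
    · rw [hz, he f s hs] at this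
      have hl := G.len_pos f
      unfold lin at this
      refine ⟨f, ?_, fun hiff => ?_⟩
      · rw [hz]; congr 1
        split_ifs at this <;> field_simp at this <;> linarith
      · by_cases h1 : G.src f ∈ S
        · rw [if_pos h1, if_pos (hiff.1 h1)] at this; norm_num at this
        · rw [if_neg h1, if_neg (fun h2 => h1 (hiff.2 h2))] at this; norm_num at this
  choose f hf hcross using key
  exact ⟨f, fun i j hij => hy (by rw [hf, hf, hij]), hcross⟩

end MetricGraph

/-! ### Geodesics avoiding an edge -/

namespace MetricGraph

variable {G : MetricGraph.{u, v}}

/-- The metric graph without the interior of the edge `e`. -/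
def del (G : MetricGraph.{u, v}) (e : G.E) : MetricGraph.{u, v} where
  V := G.V
  E := {f : G.E // f ≠ e}
  finite_V := G.finite_V
  finite_E := by have := G.finite_E; infer_instance
  len f := G.len f
  len_pos f := G.len_pos f
  src f := G.src f
  tgt f := G.tgt f

/-- `h` is the distance from `a` in the graph without the edge `e`. It is characterized, on the
vertices that can be reached from `a` without `e`, as the largest function that vanishes at `a` and
changes by at most the length along every other edge; elsewhere its values do not matter. -/
structure IsPotential (e : G.E) (a : G.V) (h : G.V → ℝ) : Prop where
  base : h a = 0
  nonneg : ∀ x, 0 ≤ h x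
  le_add : ∀ f, f ≠ e → ∀ x y, Joins f x y → h y ≤ h x + G.len f
  maximal : ∀ g : G.V → ℝ, (∀ f, f ≠ e → ∀ x y, Joins f x y → g y ≤ g x + G.len f) →
    ∀ x, Reach {f | f ≠ e} a x → g x - g a ≤ h x

theorem exists_isPotential (e : G.E) (a : G.V) : ∃ h, IsPotential e a h := by
  have hj : ∀ f : G.E, f ≠ e → ∀ x y, Joins f x y →
      ∃ f' : (G.del e).E, (G.del e).len f' = G.len f ∧ Joins (G := G.del e) f' x y :=
    fun f hf x y h => ⟨⟨f, hf⟩, rfl, h⟩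
  refine ⟨fun x => ds (G := G.del e) (vx (G := G.del e) a) (vx (G := G.del e) x),
    ds_self _, fun x => ds_nonneg _ _, fun f hf x y h => ?_, fun g hg x hx => ?_⟩
  · obtain ⟨f', hl, h'⟩ := hj f hf x y h
    have h1 := abs_ds_sub_ds_le (G := G.del e) (z := vx (G := G.del e) a) h'.near
    rw [ds_comm (G := G.del e) (vx x), ds_comm (G := G.del e) (vx y)] at h1
    have h2 := h'.ds_le
    rw [hl] at h2
    have := (abs_sub_le_iff.1 h1).2
    linarith
  · have hx' : Reach (G := G.del e) Set.univ a x :=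
      Relation.ReflTransGen.mono (fun _ _ ⟨f, hf, h⟩ => ⟨⟨f, hf⟩, trivial, h⟩) _ _ hx
    have := abs_sub_le_ds_vx (G := G.del e) g
      (fun f x y h => hg f.1 f.2 x y h) hx'.near
    exact (le_abs_self _).trans ((abs_sub_comm _ _).le.trans this)

/-- Following edges along which the potential grows by their length, one reaches every vertex:
otherwise the potential could be enlarged on the vertices not reached. -/
theorem IsPotential.reflTransGen {e : G.E} {a : G.V} {h : G.V → ℝ} (hp : IsPotential e a h)
    {b : G.V} (hb : Reach {f | f ≠ e} a b) :
    Relation.ReflTransGen (fun x y => ∃ f, f ≠ e ∧ Joins f x y ∧ h y = h x + G.len f) a b := by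
  classical
  by_contra hcon
  set R : Set G.V := {z | Relation.ReflTransGen
    (fun x y => ∃ f, f ≠ e ∧ Joins f x y ∧ h y = h x + G.len f) a z} with hR
  have haR : a ∈ R := Relation.ReflTransGen.refl
  have hbR : b ∉ R := hcon
  have hstrict : ∀ f, f ≠ e → ∀ x y, Joins f x y → x ∈ R → y ∉ R → h y < h x + G.len f := by
    intro f hf x y hj hx hy
    refine lt_of_le_of_ne (hp.le_add f hf x y hj) fun heq => hy ?_
    exact Relation.ReflTransGen.tail hx ⟨f, hf, hj, heq⟩
  obtain ⟨ε, hε, hεle⟩ : ∃ ε : ℝ, 0 < ε ∧ ∀ f, f ≠ e → ∀ x y, Joins f x y → x ∈ R → y ∉ R →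
      h y + ε ≤ h x + G.len f := by
    have := G.finite_E
    have := G.finite_V
    have : Nonempty (G.E × G.V × G.V) := ⟨(e, a, a)⟩
    let gap : G.E × G.V × G.V → ℝ := fun p =>
      if h p.2.2 < h p.2.1 + G.len p.1 then h p.2.1 + G.len p.1 - h p.2.2 else 1
    obtain ⟨q, hq⟩ := Finite.exists_min gap
    refine ⟨gap q, ?_, fun f hf x y hj hx hy => ?_⟩
    · simp only [gap]
      split_ifs with h1
      exacts [sub_pos.2 h1, one_pos]
    · have h1 := hq (f, x, y)
      rw [show gap (f, x, y) = h x + G.len f - h y from if_pos (hstrict f hf x y hj hx hy)] at h1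
      linarith
  have := hp.maximal (fun z => h z + if z ∈ R then 0 else ε) (fun f hf x y hj => by
    have h1 := hp.le_add f hf x y hj
    by_cases hx : x ∈ R <;> by_cases hy : y ∈ R <;> simp only [hx, hy, if_true, if_false]
    · linarith
    · linarith [hεle f hf x y hj hx hy]
    · linarith
    · linarith) b hb
  simp only [haR, hbR, if_true, if_false, hp.base] at this
  linarith

theorem exists_edge_path {f : G.E} {x y : G.V} (hj : Joins f x y) (κ : G.V → ℝ)
    (hκ : κ y = κ x + G.len f) :
    ∃ σ : ℝ → G.Space, LipschitzWith 1 σ ∧ σ 0 = vx x ∧ σ (G.len f) = vx y ∧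
      ∀ t ∈ Set.Icc 0 (G.len f), ∃ τ ∈ Set.Icc 0 (G.len f), σ t = pt f τ ∧
        lin (G.len f) (κ (G.src f)) (κ (G.tgt f)) τ = κ x + t := by
  have hl := G.len_pos f
  obtain ⟨rfl, rfl⟩ | ⟨rfl, rfl⟩ := hj
  · refine ⟨pt f, lipschitzWith_pt f, pt_zero f, pt_len f, fun t ht => ⟨t, ht, rfl, ?_⟩⟩
    rw [hκ, lin]; field_simp; ring
  · refine ⟨fun t => pt f (G.len f - t), ?_, ?_, ?_, fun t ht => ⟨G.len f - t, ?_, rfl, ?_⟩⟩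
    · refine (lipschitzWith_pt f).comp (Kg := 1) ?_ |>.weaken (by simp)
      exact LipschitzWith.of_dist_le_mul fun s t => by
        rw [Real.dist_eq, Real.dist_eq, abs_sub_comm s t, NNReal.coe_one, one_mul]
        exact le_of_eq (by ring_nf)
    · simp only [sub_zero, pt_len]
    · simp only [sub_self, pt_zero]
    · constructor <;> linarith [ht.1, ht.2]
    · rw [hκ, lin]; field_simp; ring

theorem lipschitzWith_concat {X : Type*} [PseudoEMetricSpace X] {γ σ : ℝ → X}
    (hγ : LipschitzWith 1 γ) (hσ : LipschitzWith 1 σ) {T : ℝ} (h : γ T = σ 0) :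
    LipschitzWith 1 fun t => if t ≤ T then γ t else σ (t - T) := by
  have key : ∀ s t, s ≤ T → T < t → edist (γ s) (σ (t - T)) ≤ edist s t := by
    intro s t hs ht
    calc edist (γ s) (σ (t - T)) ≤ edist (γ s) (γ T) + edist (γ T) (σ (t - T)) :=
          edist_triangle _ _ _
      _ ≤ edist s T + edist 0 (t - T) := by
          rw [h]
          refine add_le_add ?_ ?_
          · rw [← h]; simpa using hγ s T
          · simpa using hσ 0 (t - T)
      _ = edist s t := by
          rw [edist_dist, edist_dist, edist_dist, ← ENNReal.ofReal_add dist_nonneg dist_nonneg]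
          simp only [Real.dist_eq]
          congr 1
          rw [abs_of_nonpos (by linarith), abs_of_nonpos (by linarith), abs_of_nonpos (by linarith)]
          ring
  intro s t
  rw [ENNReal.coe_one, one_mul]
  dsimp only
  split_ifs with h1 h2 h2
  · simpa using hγ s t
  · exact key s t h1 (not_le.1 h2)
  · rw [edist_comm, edist_comm s]; exact key t s h2 (not_le.1 h1)
  · simpa [edist_dist, Real.dist_eq] using hσ (s - T) (t - T)

/-- A geodesic from `a` to `z` avoiding the edge `e`, parametrized by the potential `h`. -/
structure GeodesicArc (e : G.E) (h : G.V → ℝ) (a z : G.V) where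
  /-- the vertices on the geodesic -/
  verts : Set G.V
  /-- the edges of the geodesic -/
  edges : Set G.E
  /-- the parametrization; only its values on `[0, h z]` matter -/
  path : ℝ → G.Space
  lipschitz : LipschitzWith 1 path
  left_mem : a ∈ verts
  right_mem : z ∈ verts
  avoids : ∀ f ∈ edges, f ≠ e
  h_le : ∀ x ∈ verts, h x ≤ h z
  path_h : ∀ x ∈ verts, path (h x) = vx x
  src_mem : ∀ f ∈ edges, G.src f ∈ verts
  tgt_mem : ∀ f ∈ edges, G.tgt f ∈ verts
  cover : ∀ t ∈ Set.Icc 0 (h z), (∃ x, path t = vx x ∧ h x = t) ∨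
    ∃ f ∈ edges, ∃ τ ∈ Set.Icc 0 (G.len f),
      path t = pt f τ ∧ lin (G.len f) (h (G.src f)) (h (G.tgt f)) τ = t
  len_le : ∀ f ∈ edges, G.len f ≤ |h (G.tgt f) - h (G.src f)|
  /-- only one edge of the geodesic starts at `a` -/
  unique : ∀ f ∈ edges, ∀ f' ∈ edges, (G.src f = a ∨ G.tgt f = a) →
    (G.src f' = a ∨ G.tgt f' = a) → f = f'

theorem IsPotential.nonempty_geodesicArc {e : G.E} {a : G.V} {h : G.V → ℝ}
    (hp : IsPotential e a h) {b : G.V} (hb : Reach {f | f ≠ e} a b) :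
    Nonempty (GeodesicArc e h a b) := by
  classical
  induction hp.reflTransGen hb with
  | refl =>
    exact ⟨{
      verts := {a}
      edges := ∅
      path := fun _ => vx a
      lipschitz := LipschitzWith.const' _
      left_mem := rfl
      right_mem := rfl
      avoids := by simp
      h_le := by simp
      path_h := by simp
      src_mem := by simp
      tgt_mem := by simp
      cover := fun t ht => .inl ⟨a, rfl, by
        rw [hp.base] at ht ⊢; exact le_antisymm ht.1 ht.2⟩
      len_le := by simp
      unique := by simp }⟩
  | @tail y z hy hs ih =>
    obtain ⟨f, hf, hj, hz⟩ := hs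
    have hry : Reach {f | f ≠ e} a y :=
      Relation.ReflTransGen.mono (fun _ _ ⟨f, hf, h, _⟩ => ⟨f, hf, h⟩) _ _ hy
    obtain ⟨A⟩ := ih hry
    have hl := G.len_pos f
    obtain ⟨σ, hσ, hσ0, hσ1, hσc⟩ := exists_edge_path hj h hz
    have hends : (G.src f = y ∨ G.src f = z) ∧ (G.tgt f = y ∨ G.tgt f = z) := by
      obtain ⟨h1, h2⟩ | ⟨h1, h2⟩ := hj
      exacts [⟨.inl h1, .inr h2⟩, ⟨.inr h1, .inl h2⟩]
    have hza : z ≠ a := fun hza => by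
      have := hp.nonneg y
      rw [hza, hp.base] at hz; linarith
    -- If the new edge starts at `a`, the old arc has length `0` and hence no edges.
    have hnew : (G.src f = a ∨ G.tgt f = a) → A.edges = ∅ := by
      intro hfa
      have hya : y = a := by
        obtain ⟨h1 | h1, h2 | h2⟩ := hends <;> rcases hfa with h3 | h3 <;> simp_all
      subst hya
      refine Set.eq_empty_of_forall_notMem fun f' hf' => ?_
      have h1 := A.h_le _ (A.src_mem f' hf')
      have h2 := A.h_le _ (A.tgt_mem f' hf')
      have h3 := hp.nonneg (G.src f')
      have h4 := hp.nonneg (G.tgt f')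
      have h5 := A.len_le f' hf'
      rw [hp.base] at h1 h2
      rw [le_antisymm h1 h3, le_antisymm h2 h4, sub_self, abs_zero] at h5
      exact absurd h5 (not_le.2 (G.len_pos f'))
    exact ⟨{
      verts := insert z A.verts
      edges := insert f A.edges
      path := fun t => if t ≤ h y then A.path t else σ (t - h y)
      lipschitz := lipschitzWith_concat A.lipschitz hσ ((A.path_h y A.right_mem).trans hσ0.symm)
      left_mem := .inr A.left_mem
      right_mem := .inl rfl
      avoids := by
        rintro f' (rfl | hf')
        exacts [hf, A.avoids f' hf']
      h_le := by
        rintro x (rfl | hx)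
        exacts [le_rfl, by linarith [A.h_le x hx]]
      path_h := by
        rintro x (rfl | hx)
        · rw [if_neg (by linarith), ← hσ1]; congr 1; linarith
        · rw [if_pos (A.h_le x hx), A.path_h x hx]
      src_mem := by
        rintro f' (rfl | hf')
        · rcases hends.1 with h' | h' <;> rw [h']
          exacts [.inr A.right_mem, .inl rfl]
        · exact .inr (A.src_mem f' hf')
      tgt_mem := by
        rintro f' (rfl | hf')
        · rcases hends.2 with h' | h' <;> rw [h']
          exacts [.inr A.right_mem, .inl rfl]
        · exact .inr (A.tgt_mem f' hf')
      cover := by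
        intro t ht
        by_cases hty : t ≤ h y
        · simp only [if_pos hty]
          rcases A.cover t ⟨ht.1, hty⟩ with hx | ⟨f', hf', hx⟩
          exacts [.inl hx, .inr ⟨f', .inr hf', hx⟩]
        · simp only [if_neg hty]
          obtain ⟨τ, hτ, h1, h2⟩ := hσc (t - h y) ⟨by linarith, by linarith [ht.2]⟩
          exact .inr ⟨f, .inl rfl, τ, hτ, h1, by linarith⟩
      len_le := by
        rintro f' (rfl | hf')
        · obtain ⟨h1, h2⟩ | ⟨h1, h2⟩ := hj
          · rw [h1, h2, hz, add_sub_cancel_left]; exact le_abs_self _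
          · rw [h1, h2, hz, sub_add_cancel_left, abs_neg]; exact le_abs_self _
        · exact A.len_le f' hf'
      unique := by
        rintro f₁ (rfl | h₁) f₂ (rfl | h₂) ha₁ ha₂
        · rfl
        · rw [hnew ha₁] at h₂; exact h₂.elim
        · rw [hnew ha₂] at h₁; exact h₁.elim
        · exact A.unique f₁ h₁ f₂ h₂ ha₁ ha₂ }⟩

end MetricGraph

/-! ### An isometric cycle with an ear -/

namespace MetricGraph

variable {G : MetricGraph.{u, v}}

/-- A closed curve of length `L` along edges of the graph on which antipodal points have distance
`L / 2`. -/
structure IsometricLoop (G : MetricGraph.{u, v}) where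
  /-- the vertices on the loop -/
  verts : Set G.V
  /-- the edges of the loop -/
  edges : Set G.E
  /-- the starting vertex -/
  base : G.V
  /-- the length -/
  L : ℝ
  L_pos : 0 < L
  /-- the parametrization; only its values on `[0, L]` matter -/
  path : ℝ → G.Space
  lipschitz : LipschitzWith 1 path
  path_zero : path 0 = vx base
  path_L : path L = vx base
  base_mem : base ∈ verts
  src_mem : ∀ f ∈ edges, G.src f ∈ verts
  tgt_mem : ∀ f ∈ edges, G.tgt f ∈ verts
  exists_path_eq : ∀ x ∈ verts, ∃ θ ∈ Set.Icc 0 L, path θ = vx x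
  cover : ∀ θ ∈ Set.Icc 0 L, (∃ x, path θ = vx x) ∨
    ∃ f ∈ edges, ∃ τ ∈ Set.Icc 0 (G.len f), path θ = pt f τ
  antipodal : ∀ θ ∈ Set.Icc 0 (L / 2), L / 2 ≤ ds (path θ) (path (θ + L / 2))

/-- Closing a geodesic of `G - e` between the ends of `e` by the edge `e` gives an isometric loop.
The reason is a retraction of `G` onto the circle of length `L`: it is the potential on the
vertices and on the edges other than `e`, and `e` is mapped to the rest of the circle. -/
theorem exists_isometricLoop {e : G.E} {a b : G.V} (hab : a ≠ b) (hj : Joins e a b)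
    (hb : Reach {f | f ≠ e} a b) :
    ∃ C : IsometricLoop G, C.base = a ∧ b ∈ C.verts ∧ e ∈ C.edges ∧
      ∀ f ∈ C.edges, ∀ f' ∈ C.edges, f ≠ e → f' ≠ e → (G.src f = a ∨ G.tgt f = a) →
        (G.src f' = a ∨ G.tgt f' = a) → f = f' := by
  classical
  obtain ⟨h, hp⟩ := exists_isPotential e a
  obtain ⟨A⟩ := hp.nonempty_geodesicArc hb
  have hl := G.len_pos e
  have hb0 := hp.nonneg b
  set L := h b + G.len e with hL
  have hLpos : 0 < L := by linarith
  -- On `e` the potential is lifted to `ℝ` with the value `L` instead of `0` at `a`.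
  let κ : G.E → G.V → ℝ := fun f x => if f = e ∧ x = a then L else h x
  have hκ : κ e a = κ e b + G.len e := by simp [κ, hab.symm, hL]
  have hκne : ∀ f, f ≠ e → ∀ x, κ f x = h x := fun f hf x => by simp [κ, hf]
  have hκcoe : ∀ f x, ((κ f x : ℝ) : AddCircle L) = (h x : AddCircle L) := by
    intro f x
    simp only [κ]
    split_ifs with hx
    · rw [hx.2, hp.base, AddCircle.coe_period, AddCircle.coe_zero]
    · rfl
  obtain ⟨σ, hσ, hσ0, hσ1, hσc⟩ := exists_edge_path hj.symm (κ e) hκ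
  have hκlip : ∀ f, |κ f (G.tgt f) - κ f (G.src f)| ≤ G.len f := by
    intro f
    by_cases hf : f = e
    · subst hf
      obtain ⟨h1, h2⟩ | ⟨h1, h2⟩ := hj <;> rw [h1, h2, hκ]
      · rw [sub_add_cancel_left, abs_neg, abs_of_pos hl]
      · rw [add_sub_cancel_left, abs_of_pos hl]
    · rw [hκne f hf, hκne f hf, abs_sub_le_iff]
      have h1 := hp.le_add f hf _ _ (.inl ⟨rfl, rfl⟩)
      have h2 := hp.le_add f hf _ _ (.inr ⟨rfl, rfl⟩)
      constructor <;> linarith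
  obtain ⟨Φ, hΦ, hv, he⟩ := exists_lipschitzWith (G := G) (Y := AddCircle L)
    (fun x => (h x : AddCircle L))
    (fun f t => (lin (G.len f) (κ f (G.src f)) (κ f (G.tgt f)) t : ℝ))
    (fun f => by rw [lin_zero, hκcoe])
    (fun f => by rw [lin_self (G.len_pos f), hκcoe])
    (fun f s _ t _ => by
      rw [edist_dist, dist_eq_norm, ← AddCircle.coe_sub]
      refine ENNReal.ofReal_le_ofReal (le_trans QuotientAddGroup.norm_mk_le_norm ?_)
      exact abs_lin_sub_lin_le (G.len_pos f) (hκlip f) s t)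
  let Γ : ℝ → G.Space := fun t => if t ≤ h b then A.path t else σ (t - h b)
  have hΓ : LipschitzWith 1 Γ :=
    lipschitzWith_concat A.lipschitz hσ ((A.path_h b A.right_mem).trans hσ0.symm)
  have hcover : ∀ θ ∈ Set.Icc 0 L, (∃ x, Γ θ = vx x ∧ h x = θ) ∨
      ∃ f ∈ insert e A.edges, ∃ τ ∈ Set.Icc 0 (G.len f), Γ θ = pt f τ ∧
        lin (G.len f) (κ f (G.src f)) (κ f (G.tgt f)) τ = θ := by
    intro θ hθ
    simp only [Γ]
    split_ifs with hθb
    · rcases A.cover θ ⟨hθ.1, hθb⟩ with hx | ⟨f, hf, τ, hτ, h1, h2⟩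
      · exact .inl hx
      · refine .inr ⟨f, .inr hf, τ, hτ, h1, ?_⟩
        rw [hκne f (A.avoids f hf), hκne f (A.avoids f hf), h2]
    · obtain ⟨τ, hτ, h1, h2⟩ := hσc (θ - h b) ⟨by linarith, by linarith [hθ.2]⟩
      refine .inr ⟨e, .inl rfl, τ, hτ, h1, ?_⟩
      rw [h2]
      simp [κ, hab.symm]
  have hΦΓ : ∀ θ ∈ Set.Icc 0 L, Φ (Γ θ) = (θ : AddCircle L) := by
    intro θ hθ
    obtain ⟨x, h1, h2⟩ | ⟨f, -, τ, hτ, h1, h2⟩ := hcover θ hθ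
    · rw [h1, hv, h2]
    · rw [h1, he f τ hτ, h2]
  have hsrc : G.src e ∈ A.verts := by
    obtain ⟨h1, -⟩ | ⟨h1, -⟩ := hj <;> rw [h1]
    exacts [A.left_mem, A.right_mem]
  have htgt : G.tgt e ∈ A.verts := by
    obtain ⟨-, h1⟩ | ⟨-, h1⟩ := hj <;> rw [h1]
    exacts [A.right_mem, A.left_mem]
  have hΓA : ∀ x ∈ A.verts, Γ (h x) = vx x := fun x hx => by
    simp only [Γ]; rw [if_pos (A.h_le x hx), A.path_h x hx]
  refine ⟨{
    verts := A.verts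
    edges := insert e A.edges
    base := a
    L := L
    L_pos := hLpos
    path := Γ
    lipschitz := hΓ
    path_zero := by rw [← hΓA a A.left_mem, hp.base]
    path_L := by
      simp only [Γ]
      rw [if_neg (by linarith), hL, add_sub_cancel_left, hσ1]
    base_mem := A.left_mem
    src_mem := by
      rintro f (rfl | hf)
      exacts [hsrc, A.src_mem f hf]
    tgt_mem := by
      rintro f (rfl | hf)
      exacts [htgt, A.tgt_mem f hf]
    exists_path_eq := fun x hx =>
      ⟨h x, ⟨hp.nonneg x, (A.h_le x hx).trans (by linarith)⟩, hΓA x hx⟩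
    cover := fun θ hθ => by
      obtain ⟨x, h1, -⟩ | ⟨f, hf, τ, hτ, h1, -⟩ := hcover θ hθ
      exacts [.inl ⟨x, h1⟩, .inr ⟨f, hf, τ, hτ, h1⟩]
    antipodal := fun θ hθ => by
      have hnear : Near (Γ θ) (Γ (θ + L / 2)) :=
        near_of_edist_le (edist_path_le hΓ _ _)
      refine le_trans ?_ (dist_le_ds hΦ hnear)
      rw [hΦΓ θ ⟨hθ.1, by linarith [hθ.2]⟩,
        hΦΓ _ ⟨by linarith [hθ.1], by linarith [hθ.2]⟩, dist_comm, dist_eq_norm,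
        ← AddCircle.coe_sub, add_sub_cancel_left, AddCircle.norm_half_period_eq,
        abs_of_pos hLpos] }, rfl, A.right_mem, .inl rfl, ?_⟩
  rintro f (rfl | hf) f' (rfl | hf') hfe hfe' h1 h2
  · rfl
  · exact absurd rfl hfe
  · exact absurd rfl hfe'
  · exact A.unique f hf f' hf' h1 h2

/-- Let `a ≠ b` be vertices that no two edges separate. Then some isometric loop through `a` has an
ear: otherwise the two edges of a suitable loop at `a` would separate `a` from `b`. -/
theorem exists_isometricLoop_ear {a b : G.V} (hab : a ≠ b)
    (hcut : ∀ S : Set G.V, a ∈ S → b ∉ S →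
      ∃ f : Fin 3 → G.E, Function.Injective f ∧ ∀ i, ¬ (G.src (f i) ∈ S ↔ G.tgt (f i) ∈ S)) :
    ∃ C : IsometricLoop G, ∃ x ∈ C.verts, x ≠ C.base ∧ Reach C.edgesᶜ C.base x := by
  -- the edges that are not incident to `a`
  set F : Set G.E := {f | G.src f ≠ a ∧ G.tgt f ≠ a} with hF
  -- Some edge joins `a` to a vertex `c` from which `b` can be reached without passing through `a`.
  obtain ⟨e, c, hj, hc, hac⟩ : ∃ e c, Joins e a c ∧ Reach F b c ∧ a ≠ c := by
    have haK : ¬ Reach F b a := by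
      intro h
      rcases Relation.ReflTransGen.cases_tail h with h | ⟨y, -, f, hf, h | h⟩
      exacts [hab h, hf.2 h.2, hf.1 h.1]
    obtain ⟨f, -, hf⟩ := hcut {y | ¬ Reach F b y} haK (fun h => h .refl)
    have hstep : ∀ f x y, Joins f x y → Reach F b x → ¬ Reach F b y → y = a := by
      intro f x y hj hx hy
      have hxa : x ≠ a := fun h => haK (h ▸ hx)
      by_contra hya
      refine hy (hx.tail ⟨f, ?_, hj⟩)
      obtain ⟨rfl, rfl⟩ | ⟨rfl, rfl⟩ := hj
      exacts [⟨hxa, hya⟩, ⟨hya, hxa⟩]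
    have hf0 := hf 0
    simp only [Set.mem_ofPred_eq] at hf0
    by_cases hs : Reach F b (G.src (f 0))
    · have ht : ¬ Reach F b (G.tgt (f 0)) := by tauto
      have := hstep _ _ _ (.inl ⟨rfl, rfl⟩) hs ht
      exact ⟨f 0, _, .inr ⟨rfl, this⟩, hs, fun h => haK (h ▸ hs)⟩
    · have ht : Reach F b (G.tgt (f 0)) := by tauto
      have := hstep _ _ _ (.inr ⟨rfl, rfl⟩) ht hs
      exact ⟨f 0, _, .inl ⟨this, rfl⟩, ht, fun h => haK (h ▸ ht)⟩
  have hea : ¬ e ∈ F := by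
    obtain ⟨h, -⟩ | ⟨-, h⟩ := hj
    exacts [fun h' => h'.1 h, fun h' => h'.2 h]
  -- The edge `e` is no bridge.
  have hreach : Reach {f | f ≠ e} a c := by
    by_contra hcon
    have hb : ¬ Reach {f | f ≠ e} a b := fun h => hcon <|
      Relation.ReflTransGen.trans h (hc.mono fun f hf (hfe : f = e) => hea (hfe ▸ hf))
    obtain ⟨f, hinj, hf⟩ := hcut {y | Reach {f | f ≠ e} a y} .refl hb
    have hfe : ∀ i, f i = e := by
      intro i
      by_contra hne
      refine hf i ⟨fun h => ?_, fun h => ?_⟩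
      exacts [Relation.ReflTransGen.tail h ⟨f i, hne, .inl ⟨rfl, rfl⟩⟩,
        Relation.ReflTransGen.tail h ⟨f i, hne, .inr ⟨rfl, rfl⟩⟩]
    exact not_injective_of_eq_or_eq (fun i => .inl (hfe i)) (q := e) hinj
  obtain ⟨C, rfl, hcC, heC, huniq⟩ := exists_isometricLoop hac hj hreach
  refine ⟨C, ?_⟩
  by_contra hcon
  push Not at hcon
  have hS : ∀ x ∈ C.verts, Reach C.edgesᶜ C.base x → x = C.base := fun x hx h => by
    by_contra hne; exact hcon x hx hne h
  have hb : ¬ Reach C.edgesᶜ C.base b := by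
    have : ∀ y, Reach F c y → ¬ Reach C.edgesᶜ C.base y := by
      intro y hy
      induction hy with
      | refl => exact fun h => hac (hS c hcC h).symm
      | @tail y z _ hyz ih =>
        obtain ⟨f, hf, hj⟩ := hyz
        intro hz
        by_cases hfC : f ∈ C.edges
        · have hzv : z ∈ C.verts := by
            obtain ⟨-, rfl⟩ | ⟨rfl, -⟩ := hj
            exacts [C.tgt_mem f hfC, C.src_mem f hfC]
          have hza := hS z hzv hz
          obtain ⟨-, rfl⟩ | ⟨rfl, -⟩ := hj
          exacts [hf.2 hza, hf.1 hza]
        · exact ih (hz.tail ⟨f, hfC, hj.symm⟩)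
    exact this b hc.symm
  obtain ⟨f, hinj, hf⟩ := hcut {y | Reach C.edgesᶜ C.base y} .refl hb
  have hfC : ∀ i, f i ∈ C.edges ∧ (G.src (f i) = C.base ∨ G.tgt (f i) = C.base) := by
    intro i
    have hmem : f i ∈ C.edges := by
      by_contra hne
      refine hf i ⟨fun h => ?_, fun h => ?_⟩
      exacts [Relation.ReflTransGen.tail h ⟨f i, hne, .inl ⟨rfl, rfl⟩⟩,
        Relation.ReflTransGen.tail h ⟨f i, hne, .inr ⟨rfl, rfl⟩⟩]
    refine ⟨hmem, ?_⟩
    by_cases h1 : Reach C.edgesᶜ C.base (G.src (f i))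
    · exact .inl (hS _ (C.src_mem _ hmem) h1)
    · by_cases h2 : Reach C.edgesᶜ C.base (G.tgt (f i))
      · exact .inr (hS _ (C.tgt_mem _ hmem) h2)
      · exact absurd ⟨fun h => absurd h h1, fun h => absurd h h2⟩ (hf i)
  have hex : ∃ q, ∀ i, f i = e ∨ f i = q := by
    by_cases hall : ∀ i, f i = e
    · exact ⟨e, fun i => .inl (hall i)⟩
    · push Not at hall
      obtain ⟨j, hj⟩ := hall
      refine ⟨f j, fun i => or_iff_not_imp_left.2 fun hi => ?_⟩
      exact huniq _ (hfC i).1 _ (hfC j).1 hi hj (hfC i).2 (hfC j).2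
  obtain ⟨q, hq⟩ := hex
  exact not_injective_of_eq_or_eq hq hinj

end MetricGraph

/-! ### Six points near an isometric cycle -/

namespace MetricGraph

variable {G : MetricGraph.{u, v}}

namespace IsometricLoop

variable (C : IsometricLoop G)

theorem near (s t : ℝ) : Near (C.path s) (C.path t) :=
  near_of_edist_le (edist_path_le C.lipschitz s t)

theorem ds_le (s t : ℝ) : ds (C.path s) (C.path t) ≤ |s - t| :=
  ds_le_of_edist_le (abs_nonneg _) (edist_path_le C.lipschitz s t)

theorem near_base (t : ℝ) : Near (vx C.base) (C.path t) := C.path_zero ▸ C.near 0 t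

theorem near_vx {x : G.V} (hx : x ∈ C.verts) : Near (vx C.base) (vx x) := by
  obtain ⟨θ, -, h⟩ := C.exists_path_eq x hx
  exact h ▸ C.near_base θ

theorem exists_half {θ : ℝ} (hθ : θ ∈ Set.Icc 0 C.L) :
    ∃ φ ∈ Set.Icc 0 (C.L / 2), C.path θ = C.path φ ∨ C.path θ = C.path (φ + C.L / 2) := by
  by_cases h : θ ≤ C.L / 2
  · exact ⟨θ, ⟨hθ.1, h⟩, .inl rfl⟩
  · exact ⟨θ - C.L / 2, ⟨by linarith, by linarith [hθ.2]⟩, .inr (by rw [sub_add_cancel])⟩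

theorem sum_ds_le {θ φ : ℝ} (hθ : θ ∈ Set.Icc 0 (C.L / 2)) (hφ : φ ∈ Set.Icc 0 (C.L / 2)) :
    ds (C.path θ) (C.path φ) + ds (C.path θ) (C.path (φ + C.L / 2)) +
      (ds (C.path (θ + C.L / 2)) (C.path φ) + ds (C.path (θ + C.L / 2)) (C.path (φ + C.L / 2)))
      ≤ C.L := by
  wlog h : θ ≤ φ generalizing θ φ
  · have := this hφ hθ (le_of_not_ge h)
    rw [ds_comm (C.path φ), ds_comm (C.path φ), ds_comm (C.path (φ + C.L / 2)),
      ds_comm (C.path (φ + C.L / 2))] at this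
    linarith
  have h1 := C.ds_le θ φ
  have h2 := C.ds_le (θ + C.L / 2) (φ + C.L / 2)
  have h3 := C.ds_le (θ + C.L / 2) φ
  -- the fourth distance is estimated along the arc through the starting point
  have h4 := ds_triangle (C.near θ 0) (C.near 0 (φ + C.L / 2))
  have h5 := C.ds_le θ 0
  have h6 := C.ds_le C.L (φ + C.L / 2)
  rw [C.path_L, ← C.path_zero] at h6
  rw [abs_of_nonpos (by linarith)] at h1 h2
  rw [abs_of_nonneg (by linarith [hθ.1, hφ.2])] at h3 h5 h6
  linarith

theorem continuous_ds (p : G.Space) : Continuous fun θ => ds p (C.path θ) := by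
  refine (LipschitzWith.of_dist_le_mul (K := 1) fun s t => ?_).continuous
  rw [NNReal.coe_one, one_mul, Real.dist_eq, Real.dist_eq, ds_comm p, ds_comm p]
  exact (abs_ds_sub_ds_le (C.near s t)).trans (C.ds_le s t)

theorem path_eq_vx_or_pt {e : G.E} (he : e ∉ C.edges) {θ : ℝ} (hθ : θ ∈ Set.Icc 0 C.L) :
    (∃ z, C.path θ = vx z) ∨ ∃ f, f ≠ e ∧ ∃ t ∈ Set.Icc 0 (G.len f), C.path θ = pt f t := by
  obtain h | ⟨f, hf, h⟩ := C.cover θ hθ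
  exacts [.inl h, .inr ⟨f, fun h' => he (h' ▸ hf), h⟩]

end IsometricLoop

/-- There are two triples of points, all at finite mutual distances, for which the sum of the
distances within the triples exceeds the sum of the distances between them by at least `τ`. -/
def HasGap (G : MetricGraph.{u, v}) (τ : ℝ) : Prop :=
  ∃ B R : Finset G.Space, B.card = 3 ∧ R.card = 3 ∧
    (∀ x y : G.Space, (x ∈ B ∨ x ∈ R) → (y ∈ B ∨ y ∈ R) → edist x y ≠ ∞) ∧
    τ ≤ (∑ x ∈ R, ∑ y ∈ R, (edist x y).toReal) / 2
      + (∑ x ∈ B, ∑ y ∈ B, (edist x y).toReal) / 2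
      - ∑ x ∈ R, ∑ y ∈ B, (edist x y).toReal

theorem hasGap_of_points {o x x' r y y' b : G.Space} {τ : ℝ}
    (hx : Near o x) (hx' : Near o x') (hr : Near o r)
    (hy : Near o y) (hy' : Near o y') (hb : Near o b)
    (h1 : x ≠ x') (h2 : x ≠ r) (h3 : x' ≠ r) (h4 : y ≠ y') (h5 : y ≠ b) (h6 : y' ≠ b)
    (h : τ + (ds x y + ds x y' + (ds x' y + ds x' y')) + (ds b x + ds b x') + (ds r y + ds r y')
      + ds r b ≤ ds x x' + ds y y' + (ds r x + ds r x') + (ds b y + ds b y')) :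
    HasGap G τ := by
  classical
  have hnear : ∀ z, (z ∈ ({y, y', b} : Finset G.Space) ∨ z ∈ ({x, x', r} : Finset G.Space)) →
      Near o z := by
    intro z hz
    simp only [Finset.mem_insert, Finset.mem_singleton] at hz
    rcases hz with (rfl | rfl | rfl) | (rfl | rfl | rfl) <;> assumption
  have hsum : ∀ {p q t : G.Space}, p ≠ q → p ≠ t → q ≠ t → ∀ f : G.Space → ℝ,
      ∑ z ∈ ({p, q, t} : Finset G.Space), f z = f p + f q + f t := by
    intro p q t hpq hpt hqt f
    rw [Finset.sum_insert (by simp [hpq, hpt]), Finset.sum_pair hqt, add_assoc]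
  refine ⟨{y, y', b}, {x, x', r}, Finset.card_eq_three.2 ⟨y, y', b, h4, h5, h6, rfl⟩,
    Finset.card_eq_three.2 ⟨x, x', r, h1, h2, h3, rfl⟩,
    fun z w hz hw => (hnear z hz).symm.trans (hnear w hw), ?_⟩
  change τ ≤ (∑ x ∈ _, ∑ y ∈ _, ds x y) / 2 + (∑ x ∈ _, ∑ y ∈ _, ds x y) / 2 -
    ∑ x ∈ _, ∑ y ∈ _, ds x y
  simp only [hsum h1 h2 h3, hsum h4 h5 h6, ds_self]
  rw [ds_comm x' x, ds_comm x r, ds_comm x' r, ds_comm y' y, ds_comm y b, ds_comm y' b,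
    ds_comm x b, ds_comm x' b]
  linarith

/-- A pair of antipodal points of an isometric loop contributes the same to both sides of the
inequality as any other such pair. So a gap arises as soon as moving along an edge `e` off the loop
from `b` to `r` increases the distance to both points of one pair by at least as much as it
decreases the distance to one point of the other pair. -/
theorem hasGap_of_loop (C : IsometricLoop G) {e : G.E} (he : e ∉ C.edges)
    (hnear : Near (vx C.base) (vx (G.src e))) {θ φ r b τ : ℝ}
    (hθ : θ ∈ Set.Icc 0 (C.L / 2)) (hφ : φ ∈ Set.Icc 0 (C.L / 2))
    (hr : r ∈ Set.Ioo 0 (G.len e)) (hb : b ∈ Set.Ioo 0 (G.len e)) (hrb : |r - b| ≤ τ)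
    (h1 : ds (pt e b) (C.path θ) + τ ≤ ds (pt e r) (C.path θ))
    (h2 : ds (pt e b) (C.path (θ + C.L / 2)) + τ ≤ ds (pt e r) (C.path (θ + C.L / 2)))
    (h3 : ds (pt e r) (C.path φ) + τ ≤ ds (pt e b) (C.path φ) ∨
      ds (pt e r) (C.path (φ + C.L / 2)) + τ ≤ ds (pt e b) (C.path (φ + C.L / 2))) :
    HasGap G τ := by
  have hL := C.L_pos
  have hIcc : ∀ {θ}, θ ∈ Set.Icc 0 (C.L / 2) →
      θ ∈ Set.Icc 0 C.L ∧ θ + C.L / 2 ∈ Set.Icc 0 C.L := fun h =>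
    ⟨⟨h.1, by linarith [h.2]⟩, ⟨by linarith [h.1], by linarith [h.2]⟩⟩
  have hne : ∀ {θ}, θ ∈ Set.Icc 0 (C.L / 2) → C.path θ ≠ C.path (θ + C.L / 2) := by
    intro θ hθ heq
    have := C.antipodal θ hθ
    rw [← heq, ds_self] at this
    linarith
  have hpt : ∀ {θ t}, θ ∈ Set.Icc 0 C.L → t ∈ Set.Ioo 0 (G.len e) → C.path θ ≠ pt e t :=
    fun hθ ht => (pt_ne ht (C.path_eq_vx_or_pt he hθ)).symm
  have hne1 := near_pt e r b
  have hds := (ds_pt_le e r b).trans hrb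
  have hmove : ∀ z, ds (pt e r) z ≤ ds (pt e b) z + τ := fun z => by
    have := (abs_sub_le_iff.1 (abs_ds_sub_ds_le (z := z) hne1)).1
    linarith
  refine hasGap_of_points (C.near_base θ) (C.near_base (θ + C.L / 2))
    (hnear.trans (near_src_pt e r)) (C.near_base φ) (C.near_base (φ + C.L / 2))
    (hnear.trans (near_src_pt e b)) (hne hθ) (hpt (hIcc hθ).1 hr) (hpt (hIcc hθ).2 hr)
    (hne hφ) (hpt (hIcc hφ).1 hb) (hpt (hIcc hφ).2 hb) ?_
  have h4 := C.sum_ds_le hθ hφ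
  have h5 := C.antipodal θ hθ
  have h6 := C.antipodal φ hφ
  have h7 := hmove (C.path φ)
  have h8 := hmove (C.path (φ + C.L / 2))
  rcases h3 with h3 | h3 <;> linarith

/-- If the difference of the distances to the two ends of an edge off an isometric loop varies by at
least `1` on the loop, there is a gap. For a point `x` of the loop, geodesics from the point of `e`
at position `t` to `x` start towards the source of `e` if `2 * t` is at most `len e` plus that
difference at `x`, and towards the target otherwise. -/
theorem hasGap_of_oscillation (C : IsometricLoop G) {e : G.E} (he : e ∉ C.edges)
    (hnear : Near (vx C.base) (vx (G.src e))) {θ₁ θ₂ : ℝ}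
    (h₁ : θ₁ ∈ Set.Icc 0 C.L) (h₂ : θ₂ ∈ Set.Icc 0 C.L)
    (hosc : ds (vx (G.tgt e)) (C.path θ₂) - ds (vx (G.src e)) (C.path θ₂) + 1 ≤
      ds (vx (G.tgt e)) (C.path θ₁) - ds (vx (G.src e)) (C.path θ₁)) :
    HasGap G (1 / 12) := by
  set F : G.Space → ℝ := fun x => ds (vx (G.tgt e)) x - ds (vx (G.src e)) x with hF
  have hFle : ∀ x, |F x| ≤ G.len e := fun x => by
    rw [hF, abs_sub_comm]
    exact (abs_ds_sub_ds_le (near_src_tgt e)).trans (ds_src_tgt_le e)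
  have hF1 := abs_le.1 (hFle (C.path θ₁))
  have hF2 := abs_le.1 (hFle (C.path θ₂))
  change F (C.path θ₂) + 1 ≤ F (C.path θ₁) at hosc
  -- distances from points of `e`
  have hup1 : ∀ t ∈ Set.Ioo 0 (G.len e), ∀ x, ds (pt e t) x ≤ t + ds (vx (G.src e)) x := by
    intro t ht x
    have h1 := (abs_sub_le_iff.1 (abs_ds_sub_ds_le (z := x) (near_pt e t 0))).1
    have h2 := ds_pt_le e t 0
    rw [sub_zero, abs_of_pos ht.1] at h2
    rw [pt_zero] at h1 h2
    linarith
  have hup2 : ∀ t ∈ Set.Ioo 0 (G.len e), ∀ x,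
      ds (pt e t) x ≤ G.len e - t + ds (vx (G.tgt e)) x := by
    intro t ht x
    have h1 := (abs_sub_le_iff.1 (abs_ds_sub_ds_le (z := x) (near_pt e t (G.len e)))).1
    have h2 := ds_pt_le e t (G.len e)
    rw [abs_of_neg (by linarith [ht.2])] at h2
    rw [pt_len] at h1 h2
    linarith
  have hlow : ∀ t ∈ Set.Ioo 0 (G.len e), ∀ θ ∈ Set.Icc 0 C.L,
      min (t + ds (vx (G.src e)) (C.path θ)) (G.len e - t + ds (vx (G.tgt e)) (C.path θ)) ≤
        ds (pt e t) (C.path θ) := fun t ht θ hθ =>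
    le_ds_pt e _ (C.path_eq_vx_or_pt he hθ) (hnear.symm.trans (C.near_base θ)) ⟨ht.1.le, ht.2.le⟩
  have hlow1 : ∀ t ∈ Set.Ioo 0 (G.len e), ∀ θ ∈ Set.Icc 0 C.L,
      2 * t ≤ G.len e + F (C.path θ) →
        t + ds (vx (G.src e)) (C.path θ) ≤ ds (pt e t) (C.path θ) := by
    intro t ht θ hθ h
    have := hlow t ht θ hθ
    rwa [min_eq_left (by simp only [hF] at h; linarith)] at this
  have hlow2 : ∀ t ∈ Set.Ioo 0 (G.len e), ∀ θ ∈ Set.Icc 0 C.L,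
      G.len e + F (C.path θ) ≤ 2 * t →
        G.len e - t + ds (vx (G.tgt e)) (C.path θ) ≤ ds (pt e t) (C.path θ) := by
    intro t ht θ hθ h
    have := hlow t ht θ hθ
    rwa [min_eq_right (by simp only [hF] at h; linarith)] at this
  -- a point of the loop at which the difference takes the mean value `m`, and its antipode
  set m := (F (C.path θ₁) + F (C.path θ₂)) / 2 with hm
  obtain ⟨θ₀, hθ₀, hθ₀m⟩ : ∃ θ₀ ∈ Set.Icc 0 C.L, F (C.path θ₀) = m := by
    have hcont : Continuous fun θ => F (C.path θ) :=
      (C.continuous_ds _).sub (C.continuous_ds _)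
    obtain ⟨θ₀, h, h'⟩ := intermediate_value_uIcc (a := θ₂) (b := θ₁) hcont.continuousOn
      (show m ∈ Set.uIcc (F (C.path θ₂)) (F (C.path θ₁)) by
        rw [Set.uIcc_of_le (by linarith)]; constructor <;> linarith)
    exact ⟨θ₀, Set.uIcc_subset_Icc h₂ h₁ h, h'⟩
  obtain ⟨θ, hθ, hθm⟩ := C.exists_half hθ₀
  have hL := C.L_pos
  have hθ' : θ ∈ Set.Icc 0 C.L := ⟨hθ.1, by linarith [hθ.2]⟩
  have hθ'' : θ + C.L / 2 ∈ Set.Icc 0 C.L := ⟨by linarith [hθ.1], by linarith [hθ.2]⟩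
  have hr : (G.len e + m) / 2 ∈ Set.Ioo 0 (G.len e) := by constructor <;> linarith
  have hcases : (m ≤ F (C.path θ) ∧ m ≤ F (C.path (θ + C.L / 2))) ∨
      (F (C.path θ) ≤ m ∧ F (C.path (θ + C.L / 2)) ≤ m) := by
    rcases hθm with h | h <;> rw [h] at hθ₀m
    · rcases le_total m (F (C.path (θ + C.L / 2))) with h' | h'
      exacts [.inl ⟨hθ₀m.ge, h'⟩, .inr ⟨hθ₀m.le, h'⟩]
    · rcases le_total m (F (C.path θ)) with h' | h'
      exacts [.inl ⟨h', hθ₀m.ge⟩, .inr ⟨h', hθ₀m.le⟩]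
  rcases hcases with ⟨ha, hb⟩ | ⟨ha, hb⟩
  · -- Both antipodal points are reached through the source; compare with `θ₂`.
    have hb' : (G.len e + m) / 2 - 1 / 12 ∈ Set.Ioo 0 (G.len e) := by
      constructor <;> linarith [hr.2]
    obtain ⟨φ, hφ, hφ2⟩ := C.exists_half h₂
    have h3 : ds (pt e ((G.len e + m) / 2)) (C.path θ₂) + 1 / 12 ≤
        ds (pt e ((G.len e + m) / 2 - 1 / 12)) (C.path θ₂) := by
      have h4 := hup2 _ hr (C.path θ₂)
      have h5 := hlow2 _ hb' θ₂ h₂ (by linarith)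
      linarith
    refine hasGap_of_loop C he hnear hθ hφ hr hb' (by norm_num) ?_ ?_
      (by rcases hφ2 with h | h <;> rw [h] at h3; exacts [.inl h3, .inr h3])
    · have h4 := hlow1 _ hr θ hθ' (by linarith)
      have h5 := hup1 _ hb' (C.path θ)
      linarith
    · have h4 := hlow1 _ hr _ hθ'' (by linarith)
      have h5 := hup1 _ hb' (C.path (θ + C.L / 2))
      linarith
  · -- Both antipodal points are reached through the target; compare with `θ₁`.
    have hb' : (G.len e + m) / 2 + 1 / 12 ∈ Set.Ioo 0 (G.len e) := by
      constructor <;> linarith [hr.1]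
    obtain ⟨φ, hφ, hφ2⟩ := C.exists_half h₁
    have h3 : ds (pt e ((G.len e + m) / 2)) (C.path θ₁) + 1 / 12 ≤
        ds (pt e ((G.len e + m) / 2 + 1 / 12)) (C.path θ₁) := by
      have h4 := hup1 _ hr (C.path θ₁)
      have h5 := hlow1 _ hb' θ₁ h₁ (by linarith)
      linarith
    refine hasGap_of_loop C he hnear hθ hφ hr hb' (by norm_num) ?_ ?_
      (by rcases hφ2 with h | h <;> rw [h] at h3; exacts [.inl h3, .inr h3])
    · have h4 := hlow2 _ hr θ hθ' (by linarith)
      have h5 := hup2 _ hb' (C.path θ)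
      linarith
    · have h4 := hlow2 _ hr _ hθ'' (by linarith)
      have h5 := hup2 _ hb' (C.path (θ + C.L / 2))
      linarith

/-! ### The middle edge of a shortest ear -/

/-- Let `π x` be a vertex of the loop nearest to `x` and `s x` its distance from `x`. If every edge
off the loop whose ends have different nearest vertices gives an ear of length at least `c`, a
geodesic from `w` to a vertex of the loop other than `π w` either passes through `π w` or
completes an ear. -/
theorem min_le_ds_of_ne_nearest (hlen : ∀ e, 1 ≤ G.len e) (C : IsometricLoop G) {π : G.V → G.V}
    (hπ : ∀ z, π z ∈ C.verts) (hmin : ∀ z, ∀ q ∈ C.verts, ds (vx z) (vx (π z)) ≤ ds (vx z) (vx q))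
    {c : ℝ} (hc : ∀ f, f ∉ C.edges → ∀ x y, Joins f x y → Near (vx C.base) (vx x) → π x ≠ π y →
      c ≤ ds (vx x) (vx (π x)) + G.len f + ds (vx y) (vx (π y)))
    {w v : G.V} (hw : Near (vx C.base) (vx w)) (hv : v ∈ C.verts) (hne : v ≠ π w) :
    min (ds (vx w) (vx (π w)) + 1) (c - ds (vx w) (vx (π w))) ≤ ds (vx w) (vx v) := by
  classical
  set s : G.V → ℝ := fun z => ds (vx z) (vx (π z)) with hs
  have hs0 : ∀ z, 0 ≤ s z := fun z => ds_nonneg _ _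
  have hsC : ∀ z ∈ C.verts, s z = 0 := fun z hz =>
    le_antisymm ((hmin z z hz).trans (ds_self _).le) (hs0 z)
  have hlip : ∀ f x y, Joins f x y → s y ≤ s x + G.len f := by
    intro f x y hj
    have h1 := hmin y (π x) (hπ x)
    have h2 := (abs_sub_le_iff.1 (abs_ds_sub_ds_le (z := vx (π x)) hj.near)).2
    have h3 := hj.ds_le
    simp only [hs]
    linarith
  let A : G.V → Prop := fun z => Near (vx C.base) (vx z) ∧ π z = π w
  let g : G.V → ℝ := fun z => if A z then max (s z) (min (s z + 1) (c - s z)) else s z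
  have hg : ∀ f x y, Joins f x y → g y ≤ g x + G.len f := by
    intro f x y hj
    have h1 := hlip f x y hj
    have h2 := hlip f y x hj.symm
    have hl := hlen f
    by_cases hx : A x <;> by_cases hy : A y <;> simp only [g, hx, hy, if_true, if_false]
    · refine max_le (h1.trans (by gcongr; exact le_max_left _ _)) ?_
      refine le_trans ?_ (add_le_add_left (le_max_right _ _) _)
      rw [← min_add_add_right]
      exact min_le_min (by linarith) (by linarith)
    · exact h1.trans (by gcongr; exact le_max_left _ _)
    · refine max_le h1 ?_
      by_cases hf : f ∈ C.edges
      · have hyC : y ∈ C.verts := by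
          obtain ⟨-, rfl⟩ | ⟨rfl, -⟩ := hj
          exacts [C.tgt_mem f hf, C.src_mem f hf]
        refine (min_le_left _ _).trans ?_
        linarith [hsC y hyC, hs0 x]
      · have hxy : π y ≠ π x := fun h => hx ⟨hy.1.trans hj.symm.near, h ▸ hy.2⟩
        have := hc f hf y x hj.symm hy.1 hxy
        exact (min_le_right _ _).trans (by simp only [hs] at this ⊢; linarith)
    · exact h1
  have hvπ : π v = v := by
    by_contra hne'
    have h1 := one_le_ds_vx hlen (Ne.symm hne') ((C.near_vx hv).symm.trans (C.near_vx (hπ v)))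
    have h2 := hsC v hv
    simp only [hs] at h2
    linarith
  have key := abs_sub_le_ds_vx g hg (hw.symm.trans (C.near_vx hv))
  have hgv : g v = 0 := by
    have : ¬ A v := fun h => hne (hvπ ▸ h.2)
    simp only [g, this, if_false, hsC v hv]
  have hgw : g w = max (s w) (min (s w + 1) (c - s w)) := if_pos ⟨hw, rfl⟩
  rw [hgv, sub_zero, hgw] at key
  exact (le_max_right _ _).trans ((le_abs_self _).trans key)

/-- An isometric loop with an ear gives a gap: the edge to move along is the one in the middle of a
shortest ear. It is found as an edge whose ends have different nearest vertices on the loop. -/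
theorem hasGap_of_ear (hlen : ∀ e, 1 ≤ G.len e) (C : IsometricLoop G) {x : G.V}
    (hx : x ∈ C.verts) (hxb : x ≠ C.base) (hreach : Reach C.edgesᶜ C.base x) :
    HasGap G (1 / 12) := by
  have := G.finite_V
  have := G.finite_E
  have hnearest : ∀ z : G.V, ∃ q ∈ C.verts, ∀ q' ∈ C.verts, ds (vx z) (vx q) ≤ ds (vx z) (vx q') :=
    fun z => Set.exists_min_image C.verts (fun q => ds (vx z) (vx q)) (Set.toFinite _)
      ⟨C.base, C.base_mem⟩
  choose π hπ hmin using hnearest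
  have hfix : ∀ v ∈ C.verts, π v = v := by
    intro v hv
    by_contra hne
    have h1 := one_le_ds_vx hlen (Ne.symm hne) ((C.near_vx hv).symm.trans (C.near_vx (hπ v)))
    have h2 := hmin v v hv
    rw [ds_self] at h2
    linarith
  let T : Set G.E := {f | f ∉ C.edges ∧ Near (vx C.base) (vx (G.src f)) ∧ π (G.src f) ≠ π (G.tgt f)}
  have hT : T.Nonempty := by
    by_contra hempty
    have hno : ∀ f, f ∉ C.edges → Near (vx C.base) (vx (G.src f)) → π (G.src f) = π (G.tgt f) := by
      intro f hf hn
      by_contra hne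
      exact hempty ⟨f, hf, hn, hne⟩
    have hconst : ∀ y, Reach C.edgesᶜ C.base y → π y = C.base := by
      intro y hy
      induction hy with
      | refl => exact hfix _ C.base_mem
      | @tail y z hy hyz ih =>
        obtain ⟨f, hf, hj⟩ := hyz
        have hn := Reach.near hy
        obtain ⟨rfl, rfl⟩ | ⟨rfl, rfl⟩ := hj
        · rw [← hno f hf hn, ih]
        · rw [hno f hf (hn.trans (near_src_tgt f).symm), ih]
    exact hxb ((hfix x hx).symm.trans (hconst x hreach))
  obtain ⟨e, ⟨he, hnear, hne⟩, hemin⟩ := Set.exists_min_image T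
    (fun f => ds (vx (G.src f)) (vx (π (G.src f))) + G.len f + ds (vx (G.tgt f)) (vx (π (G.tgt f))))
    (Set.toFinite _) hT
  have hc : ∀ f, f ∉ C.edges → ∀ x y, Joins f x y → Near (vx C.base) (vx x) → π x ≠ π y →
      ds (vx (G.src e)) (vx (π (G.src e))) + G.len e + ds (vx (G.tgt e)) (vx (π (G.tgt e))) ≤
        ds (vx x) (vx (π x)) + G.len f + ds (vx y) (vx (π y)) := by
    rintro f hf x y (⟨rfl, rfl⟩ | ⟨rfl, rfl⟩) hn hxy
    · exact hemin f ⟨hf, hn, hxy⟩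
    · linarith [hemin f ⟨hf, hn.trans (near_src_tgt f).symm, hxy.symm⟩]
  have h1 := min_le_ds_of_ne_nearest hlen C hπ hmin hc hnear (hπ (G.tgt e)) hne.symm
  have h2 := min_le_ds_of_ne_nearest hlen C hπ hmin hc (hnear.trans (near_src_tgt e))
    (hπ (G.src e)) hne
  obtain ⟨θ₁, hθ₁, hp₁⟩ := C.exists_path_eq _ (hπ (G.src e))
  obtain ⟨θ₂, hθ₂, hp₂⟩ := C.exists_path_eq _ (hπ (G.tgt e))
  refine hasGap_of_oscillation C he hnear hθ₁ hθ₂ ?_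
  rw [hp₁, hp₂]
  have hl := hlen e
  -- the distances of the ends of `e` to the loop differ by at most the length of `e`
  have h3 := (abs_sub_le_iff.1 (abs_ds_sub_ds_le (z := vx (π (G.src e))) (near_src_tgt e))).2
  have h4 := (abs_sub_le_iff.1 (abs_ds_sub_ds_le (z := vx (π (G.tgt e))) (near_src_tgt e))).1
  have h5 := hmin (G.tgt e) (π (G.src e)) (hπ _)
  have h6 := hmin (G.src e) (π (G.tgt e)) (hπ _)
  have h7 := ds_src_tgt_le e
  rcases min_le_iff.1 h1 with h1 | h1 <;> rcases min_le_iff.1 h2 with h2 | h2 <;> linarith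

/-! ### Negative type -/

theorem HasGap.not_hasNegativeType {τ : ℝ} (hτ : 0 < τ) (h : HasGap G τ) :
    ¬ HasNegativeType G.Space := by
  classical
  obtain ⟨B, R, hB, hR, hfin, hgap⟩ := h
  intro hneg
  let w : G.Space → ℝ := fun x => (if x ∈ R then 1 else 0) - if x ∈ B then 1 else 0
  let ω : G.Space →₀ ℝ := Finsupp.onFinset (R ∪ B) w fun x hx => by
    by_contra hcon
    rw [Finset.mem_union, not_or] at hcon
    exact hx (by simp [w, hcon.1, hcon.2])
  have hsub : ω.support ⊆ R ∪ B := Finsupp.support_onFinset_subset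
  have hω : ∀ x, ω x = w x := fun x => rfl
  have hsum : ∀ f : G.Space → ℝ,
      ∑ x ∈ ω.support, ω x * f x = ∑ x ∈ R, f x - ∑ x ∈ B, f x := by
    intro f
    rw [Finset.sum_subset hsub fun x _ hx => by
      rw [Finsupp.notMem_support_iff.1 hx, zero_mul]]
    simp only [hω, w, sub_mul, ite_mul, one_mul, zero_mul, Finset.sum_sub_distrib,
      Finset.sum_ite_mem]
    rw [Finset.union_inter_cancel_left, Finset.union_inter_cancel_right]
  have hmem : ∀ x ∈ ω.support, x ∈ B ∨ x ∈ R := fun x hx =>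
    (Finset.mem_union.1 (hsub hx)).symm
  have h1 := hneg ω (fun x hx y hy => hfin x y (hmem x hx) (hmem y hy)) (by
    have := hsum fun _ => 1
    simpa [hB, hR] using this)
  have h2 : ∑ x ∈ ω.support, ∑ y ∈ ω.support, ω x * ω y * (edist x y).toReal =
      ∑ x ∈ R, ∑ y ∈ R, (edist x y).toReal - ∑ x ∈ R, ∑ y ∈ B, (edist x y).toReal -
        (∑ x ∈ B, ∑ y ∈ R, (edist x y).toReal - ∑ x ∈ B, ∑ y ∈ B, (edist x y).toReal) := by
    simp only [mul_assoc, ← Finset.mul_sum, hsum, Finset.sum_sub_distrib]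
  have h3 : ∑ x ∈ B, ∑ y ∈ R, (edist x y).toReal = ∑ x ∈ R, ∑ y ∈ B, (edist x y).toReal := by
    rw [Finset.sum_comm]
    simp only [edist_comm]
  rw [h2, h3] at h1
  linarith

end MetricGraph

/-- The double sums over `R` and over `B` are halved, so that each unordered pair counts once. -/
theorem theorem2 (G : MetricGraph.{u, v}) (hlen : ∀ e : G.E, 1 ≤ G.len e)
    (hθ : G.ContainsTheta) :
    (∃ B R : Finset G.Space, B.card = 3 ∧ R.card = 3 ∧
      (∀ x y : G.Space, (x ∈ B ∨ x ∈ R) → (y ∈ B ∨ y ∈ R) → edist x y ≠ ∞) ∧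
      (1 / 12 : ℝ) ≤ (∑ x ∈ R, ∑ y ∈ R, (edist x y).toReal) / 2
        + (∑ x ∈ B, ∑ y ∈ B, (edist x y).toReal) / 2
        - ∑ x ∈ R, ∑ y ∈ B, (edist x y).toReal) ∧
    ¬ HasNegativeType G.Space := by
  obtain ⟨U, W, hUW⟩ := hθ.exists_threeLinked
  obtain ⟨a, rfl⟩ := hUW.exists_eq_vx
  obtain ⟨b, rfl⟩ := hUW.symm.exists_eq_vx
  obtain ⟨C, x, hx, hne, hreach⟩ := MetricGraph.exists_isometricLoop_ear
    (fun h => hUW.1 (by rw [h])) (hUW.exists_crossing hlen)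
  have hgap := MetricGraph.hasGap_of_ear hlen C hx hne hreach
  exact ⟨hgap, hgap.not_hasNegativeType (by norm_num)⟩
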